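/- Let $\mathbb E\subset\mathbb C^3$ be the tetrablock, that is, the set of all points $(x_{11},x_{22},\det x)$, where $x$ runs over the complex $2\times 2$ matrices of operator norm $\|x\|<1$ (with respect to the Euclidean norm on $\mathbb C^2$). Then $\mathbb E$ cannot be exhausted by domains biholomorphic to convex domains: it is not true that for every compact set $K\subset\mathbb E$ there is a domain $U$ with $K\subset U\subset\mathbb E$ that is biholomorphic to a convex domain in $\mathbb C^3$. (In particular, $\mathbb E$ is not biholomorphic to a convex domain, and it is not the union of an increasing sequence of domains biholomorphic to convex domains.) -/

import Mathlib

/-- A domain in `ℂⁿ`: a nonempty connected open set. -/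
def IsDomainIn {n : ℕ} (U : Set (Fin n → ℂ)) : Prop :=
  IsOpen U ∧ IsConnected U

/-- `U` and `V` are biholomorphic: there is a holomorphic bijection from `U` onto `V`
with holomorphic inverse. -/
def AreBiholomorphic {n : ℕ} (U V : Set (Fin n → ℂ)) : Prop :=
  ∃ f g : (Fin n → ℂ) → (Fin n → ℂ),
    DifferentiableOn ℂ f U ∧ DifferentiableOn ℂ g V ∧
    Set.MapsTo f U V ∧ Set.MapsTo g V U ∧ Set.InvOn g f U V

/-- `U` is biholomorphic to a convex domain. -/
def IsBiholomorphicToConvex {n : ℕ} (U : Set (Fin n → ℂ)) : Prop :=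
  ∃ V : Set (Fin n → ℂ), IsDomainIn V ∧ Convex ℝ V ∧ AreBiholomorphic U V

/-- `D` can be exhausted by domains with the property `P`: every compact subset of `D` lies in
a domain contained in `D` that has the property `P`. (This holds in particular if `D` is the
union of an increasing sequence of such domains.) -/
def CanBeExhaustedBy {n : ℕ} (D : Set (Fin n → ℂ)) (P : Set (Fin n → ℂ) → Prop) : Prop :=
  ∀ K : Set (Fin n → ℂ), IsCompact K → K ⊆ D →
    ∃ U : Set (Fin n → ℂ), IsDomainIn U ∧ K ⊆ U ∧ U ⊆ D ∧ P U

/-- The Cartan domain of the first type: the complex `2 × 2` matrices whose operator norm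
(with respect to the Euclidean norm of `ℂ²`) is less than `1`. -/
def cartanDomainI : Set (Matrix (Fin 2) (Fin 2) ℂ) :=
  {x | ‖Matrix.toEuclideanCLM (n := Fin 2) (𝕜 := ℂ) x‖ < 1}

/-- The map `x ↦ (x₁₁, x₂₂, det x)`. -/
def tetrablockMap (x : Matrix (Fin 2) (Fin 2) ℂ) : Fin 3 → ℂ :=
  ![x 0 0, x 1 1, x.det]

/-- The tetrablock. -/
def tetrablock : Set (Fin 3 → ℂ) :=
  tetrablockMap '' cartanDomainI

/-! Three discs `z ↦ (cz, cz, pz²)` in the tetrablock, with `(c, p)` equal to `(1, 1)`, `(i, -1)`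
and `(0, -1)`, are incompatible with convexity. If a subdomain containing their restrictions to a
closed disc of radius `r` near 1 were biholomorphic to a convex domain, midpoints of transported
discs could be pulled back to discs in the tetrablock. To second order such a disc is determined by
`c₁, p₁, c₂, p₂` and one vector `q` that is the same for all pairs
(`exists_midpoint_curve_expansion`). A Schwarz lemma (`norm_le_of_curve_in_tetrablock`) then
constrains `b`, the last coordinate of `q`. For `r → 1` one pair forces `Re b ≥ 0` and another
forces `Re b < 0`; `r = 9/10` is already close enough. -/

open Filter Topology Asymptotics Metric

/-! ### Second order expansions of holomorphic maps -/

/-- A map between complex normed spaces that is differentiable near a point is strictly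
differentiable there. -/
theorem DifferentiableOn.hasStrictFDerivAt_of_mem_nhds {E F : Type*} [NormedAddCommGroup E]
    [NormedSpace ℂ E] [NormedAddCommGroup F] [NormedSpace ℂ F] {f : E → F} {s : Set E} {x : E}
    (hf : DifferentiableOn ℂ f s) (hs : s ∈ 𝓝 x) : HasStrictFDerivAt f (fderiv ℂ f x) x := by
  have hfx : HasFDerivAt f (fderiv ℂ f x) x := (hf.differentiableAt hs).hasFDerivAt
  rw [hasStrictFDerivAt_iff_isLittleO, isLittleO_iff]
  intro ε hε
  -- The factor `ε / 4` makes `h` oscillate by at most `ε / 2 * δ` on balls of radius `δ / 2`, so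
  -- Cauchy's estimate bounds its derivative by `ε`.
  have hsmall := (isLittleO_iff.1 hfx.isLittleO) (show 0 < ε / 4 by positivity)
  obtain ⟨δ, hδ, hball⟩ := Metric.eventually_nhds_iff_ball.1 (hsmall.and hs)
  set h : E → F := fun y => f y - f x - fderiv ℂ f x (y - x) with hh
  have hd : DifferentiableOn ℂ h (ball x δ) := by
    have : DifferentiableOn ℂ f (ball x δ) := hf.mono fun y hy => (hball y hy).2
    simp only [hh]
    fun_prop
  have hderiv : ∀ y ∈ ball x (δ / 2), ‖fderiv ℂ h y‖ ≤ ε := by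
    intro y hy
    have hsub : ball y (δ / 2) ⊆ ball x δ := by
      refine ball_subset_ball' ?_
      rw [mem_ball] at hy
      linarith
    have hbd : ∀ z ∈ ball x δ, ‖h z‖ ≤ ε / 4 * δ := fun z hz =>
      (hball z hz).1.trans (by
        rw [mem_ball, dist_eq_norm] at hz
        gcongr)
    have hmaps : Set.MapsTo h (ball y (δ / 2)) (closedBall (h y) (ε / 2 * δ)) := by
      intro z hz
      rw [mem_closedBall, dist_eq_norm]
      have h1 := hbd z (hsub hz)
      have h2 := hbd y (hsub (mem_ball_self (by positivity)))
      linarith [norm_sub_le (h z) (h y)]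
    have := Complex.norm_fderiv_le_div_of_mapsTo_ball (hd.mono hsub) hmaps (by positivity)
    refine this.trans (le_of_eq ?_)
    field_simp
  have hnhds : ball x (δ / 2) ×ˢ ball x (δ / 2) ∈ 𝓝 (x, x) :=
    prod_mem_nhds (ball_mem_nhds _ (by positivity)) (ball_mem_nhds _ (by positivity))
  filter_upwards [hnhds] with p hp
  have hdiff : ∀ y ∈ ball x (δ / 2), DifferentiableAt ℂ h y := fun y hy =>
    hd.differentiableAt (isOpen_ball.mem_nhds (ball_subset_ball (by linarith) hy))
  have := (convex_ball x (δ / 2)).norm_image_sub_le_of_norm_fderiv_le hdiff hderiv hp.2 hp.1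
  have heq : f p.1 - f p.2 - fderiv ℂ f x (p.1 - p.2) = h p.1 - h p.2 := by
    simp only [hh, map_sub]
    abel
  rwa [heq]

/-- Second order Taylor expansion of a holomorphic curve. -/
theorem exists_isLittleO_sq_of_differentiableOn {F : Type*} [NormedAddCommGroup F]
    [NormedSpace ℂ F] [CompleteSpace F] {h : ℂ → F} {s : Set ℂ} (hs : s ∈ 𝓝 0)
    (hh : DifferentiableOn ℂ h s) :
    ∃ a q : F, (fun z : ℂ => h z - h 0 - z • a - z ^ 2 • q) =o[𝓝 0] fun z : ℂ => z ^ 2 := by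
  set k := dslope h 0
  set l := dslope k 0
  have hl : ContinuousAt l 0 :=
    ((Complex.differentiableOn_dslope hs).2
      ((Complex.differentiableOn_dslope hs).2 hh)).continuousOn.continuousAt hs
  have heq : ∀ z, h z - h 0 - z • k 0 - z ^ 2 • l 0 = z ^ 2 • (l z - l 0) := by
    intro z
    have h1 : z • k z = h z - h 0 := by simpa using sub_smul_dslope h 0 z
    have h2 : z • l z = k z - k 0 := by simpa using sub_smul_dslope k 0 z
    rw [← h1, smul_sub, pow_two, mul_smul, mul_smul, h2, smul_sub]
  refine ⟨k 0, l 0, ?_⟩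
  simp_rw [heq]
  have : (fun z => l z - l 0) =o[𝓝 0] fun _ : ℂ => (1 : ℂ) := by
    rw [isLittleO_one_iff]
    simpa using hl.tendsto.sub_const (l 0)
  simpa using (isBigO_refl (fun z : ℂ => z ^ 2) (𝓝 0)).smul_isLittleO this

/-- Let `g` be a local left inverse of the holomorphic map `f`. The curve obtained by
transporting by `f` two curves `z ↦ c z e + p z² d`, taking the midpoint and transporting back
by `g` has a second order expansion at the origin whose nonlinear part depends on `f` and `g`
only through one vector `q`. -/
theorem exists_midpoint_curve_expansion {E F : Type*} [NormedAddCommGroup E] [NormedSpace ℂ E]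
    [NormedAddCommGroup F] [NormedSpace ℂ F] [CompleteSpace F] {f : E → F} {g : F → E}
    {U : Set E} {V : Set F} (hU : U ∈ 𝓝 0) (hV : V ∈ 𝓝 (f 0)) (hf : DifferentiableOn ℂ f U)
    (hg : DifferentiableOn ℂ g V) (hgf : ∀ x ∈ U, g (f x) = x) (e d : E) :
    ∃ q : E, ∀ c₁ p₁ c₂ p₂ : ℂ,
      (fun z : ℂ => g ((1 / 2 : ℂ) • (f ((c₁ * z) • e + (p₁ * z ^ 2) • d) +
          f ((c₂ * z) • e + (p₂ * z ^ 2) • d))) - ((c₁ + c₂) / 2 * z) • e -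
          z ^ 2 • (((c₁ - c₂) ^ 2 / 4) • q + ((p₁ + p₂) / 2) • d)) =o[𝓝 0] fun z : ℂ => z ^ 2 := by
  set A := fderiv ℂ f 0
  set B := fderiv ℂ g (f 0)
  have hA : HasStrictFDerivAt f A 0 := hf.hasStrictFDerivAt_of_mem_nhds hU
  have hB : HasStrictFDerivAt g B (f 0) := hg.hasStrictFDerivAt_of_mem_nhds hV
  have hBA : ∀ x, B (A x) = x := by
    intro x
    have h1 : HasFDerivAt (fun x => g (f x)) (B.comp A) 0 :=
      hB.hasFDerivAt.comp 0 hA.hasFDerivAt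
    have h2 : HasFDerivAt (fun x => g (f x)) (ContinuousLinearMap.id ℂ E) 0 :=
      (hasFDerivAt_id 0).congr_of_eventuallyEq (by filter_upwards [hU] with x hx using hgf x hx)
    simpa using congrArg (fun T : E →L[ℂ] E => T x) (h1.unique h2)
  have hline : ∀ c p : ℂ, Tendsto (fun z : ℂ => (c * z) • e + (p * z ^ 2) • d) (𝓝 0) (𝓝 0) := by
    intro c p
    have : Continuous fun z : ℂ => (c * z) • e + (p * z ^ 2) • d := by fun_prop
    simpa using this.tendsto 0
  have hline' : ∀ c : ℂ, Tendsto (fun z : ℂ => (c * z) • e) (𝓝 0) (𝓝 0) := by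
    intro c
    simpa using hline c 0
  obtain ⟨a, Q, hQ⟩ : ∃ a Q : F, (fun z : ℂ => f (z • e) - f 0 - z • a - z ^ 2 • Q)
      =o[𝓝 0] fun z : ℂ => z ^ 2 := by
    have hs : (fun z : ℂ => z • e) ⁻¹' U ∈ 𝓝 0 := by
      have := hline' 1
      simp only [one_mul] at this
      exact this hU
    have := exists_isLittleO_sq_of_differentiableOn (h := fun z : ℂ => f (z • e)) hs
      (hf.comp (by fun_prop) (fun _ hz => hz))
    simpa using this
  -- expansion of `f` along `z ↦ c z e`
  have hlin : ∀ c : ℂ, (fun z : ℂ => f ((c * z) • e) - f 0 - (c * z) • a - (c * z) ^ 2 • Q)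
      =o[𝓝 0] fun z : ℂ => z ^ 2 := by
    intro c
    have ht : Tendsto (fun z : ℂ => c * z) (𝓝 0) (𝓝 0) := by
      simpa using (continuous_const_mul c).tendsto (0 : ℂ)
    refine (hQ.comp_tendsto ht).trans_isBigO ?_
    simpa [Function.comp_def, mul_pow] using
      (isBigO_refl (fun z : ℂ => z ^ 2) (𝓝 0)).const_mul_left (c ^ 2)
  have hquad : ∀ c p : ℂ, (fun z : ℂ => f ((c * z) • e + (p * z ^ 2) • d) - f ((c * z) • e) -
      (p * z ^ 2) • A d) =o[𝓝 0] fun z : ℂ => z ^ 2 := by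
    intro c p
    have := (hasStrictFDerivAt_iff_isLittleO.1 hA).comp_tendsto
      ((hline c p).prodMk_nhds (hline' c))
    simp only [Function.comp_def, add_sub_cancel_left, map_smul] at this
    refine this.trans_isBigO ?_
    refine IsBigO.of_bound (‖p‖ * ‖d‖) (Eventually.of_forall fun z => ?_)
    rw [norm_smul, norm_mul]
    exact le_of_eq (by ring)
  refine ⟨B Q, fun c₁ p₁ c₂ p₂ => ?_⟩
  set c := (c₁ + c₂) / 2 with hc
  set m : ℂ → F := fun z => (1 / 2 : ℂ) • (f ((c₁ * z) • e + (p₁ * z ^ 2) • d) +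
          f ((c₂ * z) • e + (p₂ * z ^ 2) • d)) with hm
  -- The coefficient of `Q` is `(c₁² + c₂²) / 2 - c²`. Comparing `m` with `f ((c * z) • e)`, where
  -- `g` is known exactly, leaves a difference `O(z²)`, so only the first derivative of `g` matters.
  set T : F := ((c₁ - c₂) ^ 2 / 4) • Q + ((p₁ + p₂) / 2) • A d with hT
  have hmf : (fun z => m z - f ((c * z) • e) - z ^ 2 • T) =o[𝓝 0] fun z : ℂ => z ^ 2 := by
    have h1 := ((hlin c₁).add (hquad c₁ p₁)).add ((hlin c₂).add (hquad c₂ p₂))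
    refine ((h1.const_smul_left (1 / 2 : ℂ)).sub (hlin c)).congr_left fun z => ?_
    simp only [hm, hT, Pi.smul_apply]
    generalize f ((c * z) • e) = y
    rw [hc]
    module
  have hmt : Tendsto m (𝓝 0) (𝓝 (f 0)) := by
    have h1 := hA.continuousAt.tendsto.comp (hline c₁ p₁)
    have h2 := hA.continuousAt.tendsto.comp (hline c₂ p₂)
    have h3 := (h1.add h2).const_smul (1 / 2 : ℂ)
    rwa [show (1 / 2 : ℂ) • (f 0 + f 0) = f 0 by module] at h3
  have hft : Tendsto (fun z => f ((c * z) • e)) (𝓝 0) (𝓝 (f 0)) :=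
    hA.continuousAt.tendsto.comp (hline' c)
  have hbig : (fun z => m z - f ((c * z) • e)) =O[𝓝 0] fun z : ℂ => z ^ 2 := by
    have h1 : (fun z : ℂ => z ^ 2 • T) =O[𝓝 0] fun z : ℂ => z ^ 2 := by
      refine IsBigO.of_bound ‖T‖ (Eventually.of_forall fun z => ?_)
      rw [norm_smul, mul_comm]
    exact (hmf.isBigO.add h1).congr_left fun z => by module
  have hgm : (fun z => g (m z) - g (f ((c * z) • e)) - B (m z - f ((c * z) • e)))
      =o[𝓝 0] fun z : ℂ => z ^ 2 :=
    ((hasStrictFDerivAt_iff_isLittleO.1 hB).comp_tendsto (hmt.prodMk_nhds hft)).trans_isBigO hbig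
  have hBm : (fun z => B (m z - f ((c * z) • e) - z ^ 2 • T)) =o[𝓝 0] fun z : ℂ => z ^ 2 :=
    (B.isBigO_comp _ _).trans_isLittleO hmf
  refine (hgm.add hBm).congr' ?_ EventuallyEq.rfl
  filter_upwards [hline' c hU] with z hz
  rw [hgf _ hz]
  simp only [hT, map_sub, map_add, map_smul, hBA]
  abel

/-! ### Inequalities for the tetrablock -/

theorem smul_mem_cartanDomainI {W : Matrix (Fin 2) (Fin 2) ℂ}
    (hW : W ∈ unitary (Matrix (Fin 2) (Fin 2) ℂ)) {t : ℂ} (ht : ‖t‖ < 1) :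
    t • W ∈ cartanDomainI := by
  have h1 : Matrix.toEuclideanCLM (n := Fin 2) (𝕜 := ℂ) W ∈ unitary _ :=
    Unitary.map_mem _ hW
  simpa [cartanDomainI, norm_smul, CStarRing.norm_of_mem_unitary h1] using ht

theorem norm_sq_mulVec_le (x : Matrix (Fin 2) (Fin 2) ℂ) (s t : ℂ) :
    ‖x 0 0 * s + x 0 1 * t‖ ^ 2 + ‖x 1 0 * s + x 1 1 * t‖ ^ 2 ≤
      ‖Matrix.toEuclideanCLM (n := Fin 2) (𝕜 := ℂ) x‖ ^ 2 * (‖s‖ ^ 2 + ‖t‖ ^ 2) := by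
  have h := (Matrix.toEuclideanCLM (n := Fin 2) (𝕜 := ℂ) x).le_opNorm (WithLp.toLp 2 ![s, t])
  have h2 := pow_le_pow_left₀ (norm_nonneg _) h 2
  rw [mul_pow, EuclideanSpace.norm_sq_eq, EuclideanSpace.norm_sq_eq] at h2
  simpa [Fin.sum_univ_two, Matrix.mulVec, dotProduct] using h2

theorem norm_snd_lt_one_of_mem_tetrablock {x : Fin 3 → ℂ} (hx : x ∈ tetrablock) : ‖x 1‖ < 1 := by
  obtain ⟨y, hy, rfl⟩ := hx
  have h := norm_sq_mulVec_le y 0 1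
  have hy' : ‖Matrix.toEuclideanCLM (n := Fin 2) (𝕜 := ℂ) y‖ < 1 := hy
  simp only [mul_zero, mul_one, zero_add, norm_zero, norm_one] at h
  simp only [tetrablockMap, Matrix.cons_val_one, Matrix.cons_val_zero]
  nlinarith [norm_nonneg (y 1 1), norm_nonneg (Matrix.toEuclideanCLM (n := Fin 2) (𝕜 := ℂ) y),
    sq_nonneg ‖y 0 1‖]

theorem norm_le_of_mem_tetrablock {x : Fin 3 → ℂ} (hx : x ∈ tetrablock) {ζ : ℂ} (hζ : ‖ζ‖ = 1) :
    ‖x 2 * ζ - x 0‖ ≤ ‖x 1 * ζ - 1‖ := by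
  obtain ⟨y, hy, rfl⟩ := hx
  -- This vector and its image have second coordinates of equal modulus, so contractivity compares
  -- the first coordinates.
  have h := norm_sq_mulVec_le y (1 - y 1 1 * ζ) (ζ * y 1 0)
  have hy' : ‖Matrix.toEuclideanCLM (n := Fin 2) (𝕜 := ℂ) y‖ < 1 := hy
  have hsq : ‖Matrix.toEuclideanCLM (n := Fin 2) (𝕜 := ℂ) y‖ ^ 2 ≤ 1 :=
    pow_le_one₀ (norm_nonneg _) hy'.le
  have e1 : y 0 0 * (1 - y 1 1 * ζ) + y 0 1 * (ζ * y 1 0) = -(y.det * ζ - y 0 0) := by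
    rw [Matrix.det_fin_two]
    ring
  have e2 : y 1 0 * (1 - y 1 1 * ζ) + y 1 1 * (ζ * y 1 0) = y 1 0 := by ring
  rw [e1, e2, norm_neg, norm_mul, hζ, one_mul, norm_sub_rev 1] at h
  simp only [tetrablockMap, Matrix.cons_val_one, Matrix.cons_val_zero, Matrix.cons_val]
  refine le_of_sq_le_sq ?_ (norm_nonneg _)
  nlinarith [mul_le_mul_of_nonneg_right hsq
    (add_nonneg (sq_nonneg ‖y 1 1 * ζ - 1‖) (sq_nonneg ‖y 1 0‖))]

/-! ### Schwarz lemma and midpoint discs -/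

/-- If a holomorphic curve in the tetrablock has the expansion `c z (1, 1, 0) + z² t + o(z²)` at
the origin, then the point `(r c, r c, r² t₃)` satisfies the inequalities defining the closed
tetrablock. -/
theorem norm_le_of_curve_in_tetrablock {φ : ℂ → Fin 3 → ℂ} {s : Set ℂ} {r : ℝ} (hr : 0 < r)
    (hrs : closedBall 0 r ⊆ s) (hφ : DifferentiableOn ℂ φ s)
    (hmaps : ∀ z ∈ sphere (0 : ℂ) r, φ z ∈ tetrablock) {c : ℂ} {t : Fin 3 → ℂ}
    (hexp : (fun z : ℂ => φ z - (c * z) • ![1, 1, 0] - z ^ 2 • t) =o[𝓝 0] fun z : ℂ => z ^ 2)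
    {ζ : ℂ} (hζ : ‖ζ‖ = 1) :
    ‖r ^ 2 * t 2 * ζ - r * c‖ ≤ ‖r * c * ζ - 1‖ := by
  have hs : s ∈ 𝓝 (0 : ℂ) := mem_of_superset (closedBall_mem_nhds 0 hr) hrs
  have hφ0 : φ 0 = 0 := by
    have := (isLittleO_iff.1 hexp one_pos).self_of_nhds
    simpa using this
  have hd : ∀ i, DifferentiableOn ℂ (fun z => φ z i) s := fun i => differentiableOn_pi.1 hφ i
  have hcoord : ∀ i, (fun z : ℂ => φ z i - c * z * (![1, 1, 0] : Fin 3 → ℂ) i - z ^ 2 * t i)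
      =o[𝓝 0] fun z : ℂ => z ^ 2 := fun i => by
    exact isLittleO_pi.1 hexp i
  have hsq : (fun z : ℂ => z ^ 2) =o[𝓝 0] fun z : ℂ => z := by
    simpa using isLittleO_pow_pow (𝕜 := ℂ) one_lt_two
  have hderiv : ∀ i, HasDerivAt (fun z => φ z i) (c * (![1, 1, 0] : Fin 3 → ℂ) i) 0 := by
    intro i
    rw [hasDerivAt_iff_isLittleO_nhds_zero]
    have h1 : (fun z : ℂ => z ^ 2 * t i) =o[𝓝 0] fun z : ℂ => z := by
      simpa [mul_comm] using hsq.const_mul_left (t i)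
    refine (((hcoord i).trans hsq).add h1).congr_left fun z => ?_
    simp only [zero_add, hφ0, Pi.zero_apply, smul_eq_mul]
    ring
  set u := fun i => dslope (fun z => φ z i) 0 with hu
  have hud : ∀ i, DifferentiableOn ℂ (u i) s := fun i =>
    (Complex.differentiableOn_dslope hs).2 (hd i)
  have hu0 : ∀ i, u i 0 = c * (![1, 1, 0] : Fin 3 → ℂ) i := fun i => by
    simp only [hu, dslope_same]
    exact (hderiv i).deriv
  have huz : ∀ i z, z * u i z = φ z i := fun i z => by
    simpa [hφ0] using sub_smul_dslope (fun z => φ z i) 0 z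
  set w := dslope (u 2) 0 with hw
  have hwd : DifferentiableOn ℂ w s := (Complex.differentiableOn_dslope hs).2 (hud 2)
  have hwz : ∀ z, z * w z = u 2 z := fun z => by
    simpa [hu0] using sub_smul_dslope (u 2) 0 z
  have hw0 : w 0 = t 2 := by
    have h1 : Tendsto (fun z => w z - t 2) (𝓝[≠] 0) (𝓝 0) := by
      have h2 := (hcoord 2).mono (nhdsWithin_le_nhds (s := {0}ᶜ))
      refine (h2.tendsto_div_nhds_zero).congr' ?_
      filter_upwards [self_mem_nhdsWithin] with z hz
      have hz' : z ≠ 0 := hz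
      rw [← huz, ← hwz]
      simp only [Matrix.cons_val]
      field_simp
      ring
    have h3 : Tendsto (fun z => w z - t 2) (𝓝[≠] 0) (𝓝 (w 0 - t 2)) :=
      ((hwd.continuousOn.continuousAt hs).tendsto.mono_left nhdsWithin_le_nhds).sub_const _
    exact sub_eq_zero.1 (tendsto_nhds_unique h3 h1)
  have hrC : (r : ℂ) ≠ 0 := by exact_mod_cast hr.ne'
  have hcl : closure (ball (0 : ℂ) r) = closedBall 0 r := closure_ball _ hr.ne'
  have hfr : frontier (ball (0 : ℂ) r) = sphere 0 r := frontier_ball _ hr.ne'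
  have hz0 : ∀ z ∈ sphere (0 : ℂ) r, z ≠ 0 := fun z hz => ne_zero_of_mem_sphere hr.ne' ⟨z, hz⟩
  have hv : ∀ z ∈ closedBall (0 : ℂ) r, ‖r * u 1 z‖ < 1 := by
    have hdc : DiffContOnCl ℂ (fun z => r * u 1 z) (ball 0 r) :=
      DifferentiableOn.diffContOnCl (by rw [hcl]; exact ((hud 1).mono hrs).const_mul _)
    obtain ⟨z₀, hz₀, hmax⟩ := Complex.exists_mem_frontier_isMaxOn_norm isBounded_ball
      ⟨0, mem_ball_self hr⟩ hdc
    rw [hfr] at hz₀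
    rw [hcl] at hmax
    intro z hz
    refine (hmax hz).trans_lt ?_
    have h1 := norm_snd_lt_one_of_mem_tetrablock (hmaps z₀ hz₀)
    rw [← huz, norm_mul, mem_sphere_zero_iff_norm.1 hz₀] at h1
    simpa [abs_of_pos hr] using h1
  have hden : ∀ z ∈ closedBall (0 : ℂ) r, r * u 1 z * ζ - 1 ≠ 0 := by
    intro z hz h0
    have h1 := hv z hz
    have h2 : ‖r * u 1 z * ζ‖ = 1 := by rw [sub_eq_zero.1 h0, norm_one]
    rw [norm_mul, hζ, mul_one] at h2
    linarith
  -- The rotation `(x₁, x₂, x₃) ↦ (ηx₁, ηx₂, η²x₃)` with `η = r / z` turns the boundary inequality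
  -- for `φ` into `‖ψ‖ ≤ 1`; the maximum principle carries it to the centre.
  set ψ : ℂ → ℂ := fun z => (r ^ 2 * w z * ζ - r * u 0 z) / (r * u 1 z * ζ - 1) with hψ
  have hψd : DiffContOnCl ℂ ψ (ball 0 r) := by
    refine DifferentiableOn.diffContOnCl ?_
    rw [hcl]
    have h0 := (hud 0).mono hrs
    have h1 := (hud 1).mono hrs
    have h2 := hwd.mono hrs
    exact DifferentiableOn.div (by fun_prop) (by fun_prop) hden
  have hψ1 : ∀ z ∈ frontier (ball (0 : ℂ) r), ‖ψ z‖ ≤ 1 := by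
    intro z hz
    rw [hfr] at hz
    have hzne := hz0 z hz
    have hzr := mem_sphere_zero_iff_norm.1 hz
    have hη : ‖ζ * r / z‖ = 1 := by
      rw [norm_div, norm_mul, hζ, hzr, one_mul, Complex.norm_real, Real.norm_of_nonneg hr.le,
        div_self hr.ne']
    have h := norm_le_of_mem_tetrablock (hmaps z hz) hη
    have e1 : r * u 1 z * ζ - 1 = φ z 1 * (ζ * r / z) - 1 := by
      rw [← huz 1 z]
      field_simp
    have e2 : r ^ 2 * w z * ζ - r * u 0 z = (r / z) * (φ z 2 * (ζ * r / z) - φ z 0) := by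
      rw [← huz 2 z, ← huz 0 z, ← hwz z]
      field_simp
    have e3 : ‖(r : ℂ) / z‖ = 1 := by
      rw [norm_div, hzr, Complex.norm_real, Real.norm_of_nonneg hr.le, div_self hr.ne']
    simp only [hψ]
    rw [norm_div, e2, e1, norm_mul, e3, one_mul]
    exact div_le_one_of_le₀ h (norm_nonneg _)
  have h0 : (0 : ℂ) ∈ closure (ball (0 : ℂ) r) := subset_closure (mem_ball_self hr)
  have hfin := Complex.norm_le_of_forall_mem_frontier_norm_le isBounded_ball hψd hψ1 h0
  have hdp := hden 0 (mem_closedBall_self hr.le)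
  simp only [hψ] at hfin
  rw [norm_div, div_le_one (norm_pos_iff.2 hdp), hw0, hu0, hu0] at hfin
  simpa using hfin

/-- If a subdomain of the tetrablock is biholomorphic to a convex domain, then there is a number
`b` such that midpoints of points `(c, c, p)`, corrected by a multiple of `b`, satisfy the
inequalities defining the closed tetrablock. -/
theorem exists_midpoint_norm_le {U : Set (Fin 3 → ℂ)} (hUo : IsOpen U) (h0 : 0 ∈ U)
    (hU : U ⊆ tetrablock) (hconv : IsBiholomorphicToConvex U) {r : ℝ} (hr : 0 < r) :
    ∃ b : ℂ, ∀ c₁ p₁ c₂ p₂ : ℂ,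
      (∀ z ∈ closedBall (0 : ℂ) r, ![c₁ * z, c₁ * z, p₁ * z ^ 2] ∈ U) →
      (∀ z ∈ closedBall (0 : ℂ) r, ![c₂ * z, c₂ * z, p₂ * z ^ 2] ∈ U) →
      ∀ ζ : ℂ, ‖ζ‖ = 1 →
        ‖r ^ 2 * ((c₁ - c₂) ^ 2 / 4 * b + (p₁ + p₂) / 2) * ζ - r * ((c₁ + c₂) / 2)‖ ≤
          ‖r * ((c₁ + c₂) / 2) * ζ - 1‖ := by
  obtain ⟨V, ⟨hVo, -⟩, hVc, f, g, hf, hg, hfm, hgm, hinv, -⟩ := hconv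
  obtain ⟨q, hq⟩ := exists_midpoint_curve_expansion (hUo.mem_nhds h0)
    (hVo.mem_nhds (hfm h0)) hf hg (fun x hx => hinv hx) ![1, 1, 0] ![0, 0, 1]
  have hcurve : ∀ c p z : ℂ, (c * z) • (![1, 1, 0] : Fin 3 → ℂ) + (p * z ^ 2) • ![0, 0, 1] =
      ![c * z, c * z, p * z ^ 2] := by
    intro c p z
    ext i
    fin_cases i <;> simp
  refine ⟨q 2, fun c₁ p₁ c₂ p₂ h₁ h₂ ζ hζ => ?_⟩
  have hexp := hq c₁ p₁ c₂ p₂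
  simp_rw [hcurve] at hexp
  set γ₁ : ℂ → Fin 3 → ℂ := fun z => ![c₁ * z, c₁ * z, p₁ * z ^ 2] with hγ₁
  set γ₂ : ℂ → Fin 3 → ℂ := fun z => ![c₂ * z, c₂ * z, p₂ * z ^ 2] with hγ₂
  have hγ : ∀ c p : ℂ, Differentiable ℂ fun z : ℂ => ![c * z, c * z, p * z ^ 2] := by
    intro c p
    rw [differentiable_pi]
    intro i
    fin_cases i <;> simp <;> fun_prop
  have hmid : ∀ z ∈ closedBall (0 : ℂ) r, (1 / 2 : ℂ) • (f (γ₁ z) + f (γ₂ z)) ∈ V := by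
    intro z hz
    have := hVc (hfm (h₁ z hz)) (hfm (h₂ z hz)) (a := 1 / 2) (b := 1 / 2) (by norm_num)
      (by norm_num) (by norm_num)
    convert this using 1
    ext i
    simp [mul_add, hγ₁, hγ₂]
  have hφ : DifferentiableOn ℂ (fun z => g ((1 / 2 : ℂ) • (f (γ₁ z) + f (γ₂ z))))
      (closedBall 0 r) := by
    have d₁ : DifferentiableOn ℂ (fun z => f (γ₁ z)) (closedBall 0 r) :=
      hf.comp (hγ c₁ p₁).differentiableOn h₁
    have d₂ : DifferentiableOn ℂ (fun z => f (γ₂ z)) (closedBall 0 r) :=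
      hf.comp (hγ c₂ p₂).differentiableOn h₂
    exact hg.comp ((d₁.add d₂).const_smul (1 / 2 : ℂ)) hmid
  have := norm_le_of_curve_in_tetrablock hr subset_rfl hφ
    (fun z hz => hU (hgm (hmid z (sphere_subset_closedBall hz)))) hexp hζ
  simpa using this

/-! ### Test discs and the contradiction -/

theorem scalar_curve_mem_tetrablock {a z : ℂ} (ha : ‖a‖ = 1) (hz : ‖z‖ < 1) :
    ![a * z, a * z, a ^ 2 * z ^ 2] ∈ tetrablock := by
  refine ⟨(a * z) • 1, smul_mem_cartanDomainI (one_mem _) (by simpa [ha] using hz), ?_⟩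
  ext i
  fin_cases i <;> simp [tetrablockMap, mul_pow]

theorem antidiagonal_curve_mem_tetrablock {z : ℂ} (hz : ‖z‖ < 1) :
    ![0, 0, -z ^ 2] ∈ tetrablock := by
  refine ⟨z • !![0, 1; 1, 0], smul_mem_cartanDomainI ?_ hz, ?_⟩
  · rw [Unitary.mem_iff]
    constructor <;> ext i j <;> fin_cases i <;> fin_cases j <;>
      simp [Matrix.mul_apply, Fin.sum_univ_two, Matrix.star_apply]
  · ext i
    fin_cases i <;> simp [tetrablockMap, Matrix.det_fin_two, pow_two]

theorem theorem2 : ¬ CanBeExhaustedBy tetrablock IsBiholomorphicToConvex := by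
  intro hexh
  set r : ℝ := 9 / 10 with hr
  have hlt : ∀ z ∈ closedBall (0 : ℂ) r, ‖z‖ < 1 := fun z hz =>
    (mem_closedBall_zero_iff.1 hz).trans_lt (by norm_num [hr])
  set γ : ℂ → ℂ → ℂ → Fin 3 → ℂ := fun c p z => ![c * z, c * z, p * z ^ 2] with hγ
  have hcompact : ∀ c p, IsCompact (γ c p '' closedBall 0 r) := fun c p =>
    (isCompact_closedBall 0 r).image (by
      refine continuous_pi fun i => ?_
      fin_cases i <;> simp [hγ] <;> fun_prop)
  have hsub₁ : γ 1 1 '' closedBall 0 r ⊆ tetrablock := by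
    rintro _ ⟨z, hz, rfl⟩
    simpa [hγ] using scalar_curve_mem_tetrablock (a := 1) (by simp) (hlt z hz)
  have hsub₂ : γ Complex.I (-1) '' closedBall 0 r ⊆ tetrablock := by
    rintro _ ⟨z, hz, rfl⟩
    simpa [hγ] using scalar_curve_mem_tetrablock (a := Complex.I) (by simp) (hlt z hz)
  have hsub₃ : γ 0 (-1) '' closedBall 0 r ⊆ tetrablock := by
    rintro _ ⟨z, hz, rfl⟩
    simpa [hγ] using antidiagonal_curve_mem_tetrablock (hlt z hz)
  obtain ⟨U, ⟨hUo, -⟩, hK, hUE, hUc⟩ := hexh _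
    (((hcompact 1 1).union (hcompact Complex.I (-1))).union (hcompact 0 (-1)))
    (Set.union_subset (Set.union_subset hsub₁ hsub₂) hsub₃)
  obtain ⟨⟨hK₁, hK₂⟩, hK₃⟩ : (γ 1 1 '' closedBall 0 r ⊆ U ∧
      γ Complex.I (-1) '' closedBall 0 r ⊆ U) ∧ γ 0 (-1) '' closedBall 0 r ⊆ U := by
    simpa only [Set.union_subset_iff] using hK
  rw [Set.image_subset_iff] at hK₁ hK₂ hK₃
  have hrpos : 0 < r := by norm_num [hr]
  have h0 : (0 : Fin 3 → ℂ) ∈ U := by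
    have : γ 1 1 0 ∈ U := hK₁ (mem_closedBall_self hrpos.le)
    convert this
    ext i
    fin_cases i <;> simp [hγ]
  obtain ⟨b, hb⟩ := exists_midpoint_norm_le hUo h0 hUE hUc hrpos
  have hA := hb 0 (-1) 1 1 hK₃ hK₁ 1 norm_one
  -- For this `ζ` and `r = 1`, the second pair gives `‖b + (7 - i) / 5‖ ≤ 2 / √10`, a disc in the
  -- open left half-plane.
  have hζ : ‖(4 - 3 * Complex.I) / 5‖ = 1 := by
    rw [← sq_eq_sq₀ (norm_nonneg _) zero_le_one, ← Complex.normSq_eq_norm_sq, Complex.normSq_apply]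
    norm_num
  have hB := hb 1 1 Complex.I (-1) hK₁ hK₂ _ hζ
  rw [← sq_le_sq₀ (norm_nonneg _) (norm_nonneg _), ← Complex.normSq_eq_norm_sq,
    ← Complex.normSq_eq_norm_sq, Complex.normSq_apply, Complex.normSq_apply] at hA hB
  simp [hr, pow_two] at hA hB
  -- `hA` reads `‖81b/400 - 9/20‖ ≤ 11/20`; the leftmost point of this disc gives the bound.
  have hre : -1 / 10 ≤ 81 / 400 * b.re := by
    nlinarith [sq_nonneg b.im]
  nlinarith [sq_nonneg b.im]
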